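/- Let $\mathbb F_{25}$ be a field with 25 elements. There is an element $\epsilon\in\mathbb F_{25}$ with $\epsilon^2=\epsilon+3$, and for every such $\epsilon$ the following holds. Let $x=(x_1,\dots,x_7)=(\epsilon^{10},\epsilon^{10},1,\epsilon^6,\epsilon^3,\epsilon^6,1)$ and let $\mathrm M$ be the $7\times7$ circulant matrix with first row $x$, that is, the matrix with $(i,j)$ entry $x_{j-i+1}$, indices modulo $7$. Then $\mathrm M$ is non-singular; for every $m\in\{1,2,3\}$ all $m\times m$ submatrices of $\mathrm M$ are non-singular and $$H_m(x)=\sum_{i=1}^7 x_i\,x_{i+m}^5=0$$ (indices modulo $7$); and $\sum_{i=1}^7 x_i^{6}\neq 0$. Moreover, there exists a $[\![14,0,8]\!]_5$ quantum MDS code and, for every $r=0,\dots,6$, a $[\![14-r,r,8-r]\!]_5$ quantum MDS code. Here a $[\![n,k,d]\!]_5$ quantum code is a $5^k$-dimensional subspace $Q$ of $(\mathbb C^5)^{\otimes n}$ with minimum distance exactly $d$. Errors are the tensor products of $n$ generalised Pauli operators $X(a)Z(b)$, $a,b\in\mathbb F_5$, where $X(a)|y\rangle=|y+a\rangle$ and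 $Z(b)|y\rangle=e^{2\pi i by/5}|y\rangle$; the weight of an error is the number of components that are not the identity. With $P$ the orthogonal projection onto $Q$, an error $E$ is detected if $PEP=cP$ for some $c\in\mathbb C$. If $\dim Q>1$, the minimum distance is the least weight of an error that is not detected; if $\dim Q=1$, it is, by the usual convention, the least positive weight of an error $E$ with $PEP\neq0$. The code is a quantum MDS code if $k=n-2d+2$. -/

import Mathlib

/-! ### Circulant matrices and the forms `H_m` -/

/-- The `k × k` circulant matrix with first row `x`: every row is the cyclic shift of the previous
row by one place to the right, so that the `(i, j)` entry is `x (j - i)`, indices modulo `k`. -/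
def rowCirculant {K : Type*} {k : ℕ} (x : Fin k → K) : Matrix (Fin k) (Fin k) K :=
  Matrix.of fun i j => x (j - i)

/-- `H_m(x) = ∑ i, x_i * x_{i+m} ^ q`, indices modulo `k`. -/
def hermitianShift {K : Type*} [Field K] {k : ℕ} [NeZero k] (q : ℕ) (x : Fin k → K) (m : ℕ) : K :=
  ∑ i : Fin k, x i * x (i + Fin.ofNat k m) ^ q

/-- The conditions on the first row `x` of a circulant matrix over a field with `q ^ 2` elements:
the matrix is non-singular; for all `m = 1, …, ⌊k / 2⌋` all its `m × m` submatrices are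
non-singular and `H_m(x) = 0`; and `∑ i, x_i ^ (q + 1) ≠ 0`. -/
structure IsMDSCirculantRow {K : Type*} [Field K] {k : ℕ} [NeZero k] (q : ℕ)
    (x : Fin k → K) : Prop where
  det_ne_zero : (rowCirculant x).det ≠ 0
  minors_ne_zero : ∀ m : ℕ, 1 ≤ m → m ≤ k / 2 → ∀ r c : Fin m ↪o Fin k,
    ((rowCirculant x).submatrix r c).det ≠ 0
  hermitianShift_eq_zero : ∀ m : ℕ, 1 ≤ m → m ≤ k / 2 → hermitianShift q x m = 0
  sum_ne_zero : ∑ i, x i ^ (q + 1) ≠ 0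

/-! ### Quantum codes

`F` is the finite field with `q` elements, of characteristic `p`. The space `(ℂ^q)^{⊗ n}` is modelled
by its orthonormal basis `|x₁ … xₙ⟩ = |x₁⟩ ⊗ ⋯ ⊗ |xₙ⟩`, `x ∈ F ^ n`. -/

/-- `(ℂ^q)^{⊗ n}`, where `q` is the cardinality of `F`. -/
abbrev QuditSpace (F : Type*) [Fintype F] (n : ℕ) : Type _ := EuclideanSpace ℂ (Fin n → F)

/-- The generalised Pauli operator `X(a)|x⟩ = |x + a⟩`, as a matrix (rows index the output). -/
def pauliX {F : Type*} [Field F] [DecidableEq F] (a : F) : Matrix F F ℂ :=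
  Matrix.of fun y x => if y = x + a then 1 else 0

/-- The generalised Pauli operator `Z(b)|x⟩ = exp(2πi tr(bx)/p) |x⟩`, with `tr` the trace from `F`
to the prime field. -/
noncomputable def pauliZ (p : ℕ) [Fact p.Prime] {F : Type*} [Field F] [DecidableEq F]
    [Algebra (ZMod p) F] (b : F) : Matrix F F ℂ :=
  Matrix.diagonal fun x => ZMod.stdAddChar (Algebra.trace (ZMod p) F (b * x))

/-- The tensor product of `n` operators, in the basis `|x₁ … xₙ⟩`. -/
def tensorMatrix {F : Type*} {n : ℕ} (A : Fin n → Matrix F F ℂ) :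
    Matrix (Fin n → F) (Fin n → F) ℂ :=
  Matrix.of fun y x => ∏ i, A i (y i) (x i)

/-- The Pauli error `X(a₁)Z(b₁) ⊗ ⋯ ⊗ X(aₙ)Z(bₙ)`. -/
noncomputable def pauliError (p : ℕ) [Fact p.Prime] {F : Type*} [Field F] [Fintype F]
    [DecidableEq F] [Algebra (ZMod p) F] {n : ℕ} (a b : Fin n → F) :
    QuditSpace F n →ₗ[ℂ] QuditSpace F n :=
  Matrix.toEuclideanLin (tensorMatrix fun i => pauliX (a i) * pauliZ p (b i))

/-- The weight of a Pauli error: the number of components that are not the identity, that is,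
the number of `i` with `(aᵢ, bᵢ) ≠ (0, 0)`. -/
def pauliWeight {F : Type*} [Field F] [DecidableEq F] {n : ℕ} (a b : Fin n → F) : ℕ :=
  hammingNorm fun i => (a i, b i)

/-- The code `Q` detects the error `E`: `P E P = c P` for a scalar `c`, where `P` is the orthogonal
projection onto `Q`. It is written out here through inner products of elements of `Q`. -/
def Detects {F : Type*} [Fintype F] {n : ℕ} (Q : Submodule ℂ (QuditSpace F n))
    (E : QuditSpace F n →ₗ[ℂ] QuditSpace F n) : Prop :=
  ∃ c : ℂ, ∀ u ∈ Q, ∀ v ∈ Q, inner ℂ u (E v) = c * inner ℂ u v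

/-- The Pauli errors that limit the minimum distance of `Q`: those that are not detected and, if `Q`
is one-dimensional (so that everything is detected), the errors other than the identity with a
non-zero expectation. The second clause is the usual convention that a one-dimensional code of
minimum distance `d` has to be pure. -/
def IsHarmful (p : ℕ) [Fact p.Prime] {F : Type*} [Field F] [Fintype F] [DecidableEq F]
    [Algebra (ZMod p) F] {n : ℕ} (Q : Submodule ℂ (QuditSpace F n)) (a b : Fin n → F) : Prop :=
  ¬ Detects Q (pauliError p a b) ∨
    (Module.finrank ℂ Q = 1 ∧ pauliWeight a b ≠ 0 ∧ ∃ u ∈ Q, inner ℂ u (pauliError p a b u) ≠ 0)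

/-- `Q` is an `[[n, k, d]]_q` quantum code: a subspace of `(ℂ^q)^{⊗ n}` of dimension `q ^ k` whose
minimum distance, the least weight of a harmful Pauli error, is exactly `d`. -/
structure IsQuantumCode (p : ℕ) [Fact p.Prime] {F : Type*} [Field F] [Fintype F] [DecidableEq F]
    [Algebra (ZMod p) F] {n : ℕ} (Q : Submodule ℂ (QuditSpace F n)) (k d : ℕ) : Prop where
  finrank_eq : Module.finrank ℂ Q = Fintype.card F ^ k
  minDist : IsLeast {w : ℕ | ∃ a b : Fin n → F, pauliWeight a b = w ∧ IsHarmful p Q a b} d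

/-- An `[[n, k, d]]_q` quantum MDS code: a quantum code with equality in the quantum Singleton bound
`k ≤ n - 2 d + 2`. -/
structure IsQuantumMDSCode (p : ℕ) [Fact p.Prime] {F : Type*} [Field F] [Fintype F]
    [DecidableEq F] [Algebra (ZMod p) F] {n : ℕ} (Q : Submodule ℂ (QuditSpace F n))
    (k d : ℕ) : Prop extends IsQuantumCode p Q k d where
  singleton_eq : k + 2 * d = n + 2

instance fact_prime_five_inst : Fact (Nat.Prime 5) := ⟨by norm_num⟩

/-! Write `M*` for the conjugate transpose under `z ↦ z ^ 5`. The entries of `M M*` are the sums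
`H_m(x)` and, on the diagonal, `∑ x_i ^ 6 = 1`, so `M M* = 1`. If `u` has weight `m ≤ 3` and `(u,
uM)` has weight at most 7, then `uM` has `m` zeros, which makes an `m × m` minor of `M` vanish. The
case of light `uM` is symmetric, since `M⁻¹ = M*` has conjugate minors. Hence `{(u, uM)}` has
minimum weight at least 8 over `𝔽₂₅`.

In suitable `𝔽₅`-coordinates this code is `{(α, Aα)}` with `A` symmetric, the stabiliser of a graph
state. A Pauli error has non-zero matrix elements between the vectors of a graph code only if its
label is `(a, Pa + Bσ)`, so distance is read off from weights. Taking `P` and `B` to be blocks of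
`A` removes `r` coordinates: the dimension becomes `5 ^ r` and the distance drops by exactly `r`,
because some vector of weight 8 is supported on them.

The claims about `M` are checked in the model `GF25` and carried to any field by `ω ↦ ε`. -/

/-! ### Graph codes -/

section GraphCode

open Matrix

variable (p : ℕ) [Fact p.Prime] {F : Type*} [Field F] [Fintype F] [DecidableEq F]
  [Algebra (ZMod p) F]

variable (F) in
/-- The additive character `x ↦ exp (2πi tr(x) / p)` of a finite field of characteristic `p`. -/
noncomputable def traceChar : AddChar F ℂ :=
  ZMod.stdAddChar.compAddMonoidHom (Algebra.trace (ZMod p) F).toAddMonoidHom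

omit [Fintype F] [DecidableEq F] in
theorem traceChar_apply (x : F) :
    traceChar p F x = ZMod.stdAddChar (Algebra.trace (ZMod p) F x) := rfl

variable (F) in
omit [DecidableEq F] in
theorem traceChar_ne_one : traceChar p F ≠ 1 := by
  obtain ⟨x, hx⟩ : ∃ x : F, Algebra.trace (ZMod p) F x ≠ 0 := by
    by_contra! h
    exact Algebra.trace_ne_zero (ZMod p) F (LinearMap.ext h)
  refine AddChar.ne_one_iff.2 ⟨x, fun h => hx (ZMod.injective_stdAddChar ?_)⟩
  rw [← traceChar_apply, h, AddChar.map_zero_eq_one]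

theorem sum_traceChar_dotProduct {n : ℕ} (w : Fin n → F) :
    ∑ y : Fin n → F, traceChar p F (y ⬝ᵥ w) =
      if w = 0 then (Fintype.card F : ℂ) ^ n else 0 := by
  split_ifs with hw
  · simp [hw]
  · obtain ⟨i, hi⟩ := Function.ne_iff.1 hw
    obtain ⟨x, hx⟩ := AddChar.ne_one_iff.1 (traceChar_ne_one p F)
    let φ : AddChar (Fin n → F) ℂ :=
      (traceChar p F).compAddMonoidHom
        ⟨⟨fun y => y ⬝ᵥ w, zero_dotProduct w⟩, fun y z => add_dotProduct y z w⟩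
    -- Orthogonality of characters: scaling by `1 / w i` makes the character take the value `χ(x) ≠
    -- 1`.
    refine AddChar.sum_eq_zero_of_ne_one (ψ := φ) (AddChar.ne_one_iff.2 ⟨Pi.single i (x / w i), ?_⟩)
    change traceChar p F (Pi.single i (x / w i) ⬝ᵥ w) ≠ 1
    rwa [single_dotProduct, div_mul_cancel₀ _ hi]

theorem pauliError_apply {n : ℕ} (a b : Fin n → F) (u : QuditSpace F n) (y : Fin n → F) :
    pauliError p a b u y = traceChar p F (b ⬝ᵥ (y - a)) * u (y - a) := by
  have key : ∀ x : Fin n → F, tensorMatrix (fun i => pauliX (a i) * pauliZ p (b i)) y x =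
      if x = y - a then traceChar p F (b ⬝ᵥ (y - a)) else 0 := by
    intro x
    simp only [tensorMatrix, of_apply, pauliX, pauliZ, mul_diagonal, ite_mul, one_mul, zero_mul]
    split_ifs with h
    · subst h
      have : ∏ i, traceChar p F (b i * (y - a) i) = traceChar p F (∑ i, b i * (y - a) i) :=
        (map_prod (traceChar p F).toMonoidHom _ _).symm
      simpa [dotProduct, traceChar_apply] using this
    · obtain ⟨i, hi⟩ := Function.ne_iff.1 h
      refine Finset.prod_eq_zero (Finset.mem_univ i) (if_neg fun h' => hi ?_)
      rw [Pi.sub_apply, h', add_sub_cancel_right]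
  change (tensorMatrix _ *ᵥ u.ofLp) y = _
  simp [mulVec, dotProduct, key]

variable {n : ℕ} {κ : Type*} [Fintype κ]

/-- The vector `∑ y, χ(½ yᵀPy + yᵀBs) |y⟩`, where `χ` is the trace character. -/
noncomputable def graphVector (P : Matrix (Fin n) (Fin n) F) (B : Matrix (Fin n) κ F) (s : κ → F) :
    QuditSpace F n :=
  WithLp.toLp 2 fun y => traceChar p F (2⁻¹ * (y ⬝ᵥ P *ᵥ y) + y ⬝ᵥ B *ᵥ s)

/-- The code spanned by the vectors `∑ y, χ(½ yᵀPy + yᵀBs) |y⟩`. -/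
noncomputable def graphCode (P : Matrix (Fin n) (Fin n) F) (B : Matrix (Fin n) κ F) :
    Submodule ℂ (QuditSpace F n) :=
  Submodule.span ℂ (Set.range (graphVector p P B))

/-- The quadratic phases in `y` cancel, leaving a constant phase times the sum over `y` of `χ(yᵀ(b -
Pa - B(s - t)))`. -/
theorem inner_graphVector_pauliError (h2 : (2 : F) ≠ 0) {P : Matrix (Fin n) (Fin n) F}
    (hP : P.IsSymm) (B : Matrix (Fin n) κ F) (a b : Fin n → F) (s t : κ → F) :
    inner ℂ (graphVector p P B s) (pauliError p a b (graphVector p P B t)) =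
      traceChar p F (2⁻¹ * (a ⬝ᵥ P *ᵥ a) - b ⬝ᵥ a - a ⬝ᵥ B *ᵥ t) *
        if b = P *ᵥ a + B *ᵥ (s - t) then (Fintype.card F : ℂ) ^ n else 0 := by
  have hiff : b = P *ᵥ a + B *ᵥ (s - t) ↔ b - P *ᵥ a - B *ᵥ (s - t) = 0 := by
    rw [sub_sub, sub_eq_zero]
  simp only [hiff, ← sum_traceChar_dotProduct p, Finset.mul_sum, PiLp.inner_apply, pauliError_apply]
  refine Finset.sum_congr rfl fun y _ => ?_
  -- Symmetry of `P` merges the two cross terms, which absorbs the factor ½.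
  have hy : y ⬝ᵥ P *ᵥ a = a ⬝ᵥ P *ᵥ y := by
    rw [dotProduct_mulVec, ← mulVec_transpose, hP.eq, dotProduct_comm]
  simp only [graphVector, RCLike.inner_apply, ← AddChar.map_neg_eq_conj, ← AddChar.map_add_eq_mul]
  congr 1
  simp only [dotProduct_sub, sub_dotProduct, mulVec_sub, hy, dotProduct_comm b y]
  field_simp
  ring

theorem pauliError_zero_zero (u : QuditSpace F n) : pauliError p 0 0 u = u := by
  ext y
  simp [pauliError_apply]

theorem inner_graphVector (h2 : (2 : F) ≠ 0) {P : Matrix (Fin n) (Fin n) F}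
    (hP : P.IsSymm) (B : Matrix (Fin n) κ F) (s t : κ → F) :
    inner ℂ (graphVector p P B s) (graphVector p P B t) =
      if B *ᵥ (s - t) = 0 then (Fintype.card F : ℂ) ^ n else 0 := by
  rw [← pauliError_zero_zero p (graphVector p P B t), inner_graphVector_pauliError p h2 hP]
  simp [eq_comm]

omit [Field F] [DecidableEq F] in
theorem inner_map_eq_of_mem_span {ι : Type*} {v : ι → QuditSpace F n}
    {E : QuditSpace F n →ₗ[ℂ] QuditSpace F n} {c : ℂ}
    (h : ∀ s t, inner ℂ (v s) (E (v t)) = c * inner ℂ (v s) (v t)) :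
    ∀ x ∈ Submodule.span ℂ (Set.range v), ∀ y ∈ Submodule.span ℂ (Set.range v),
      inner ℂ x (E y) = c * inner ℂ x y := by
  intro x hx y hy
  induction hx using Submodule.span_induction with
  | mem x hx =>
    obtain ⟨s, rfl⟩ := hx
    induction hy using Submodule.span_induction with
    | mem y hy => obtain ⟨t, rfl⟩ := hy; exact h s t
    | zero => simp
    | add y z _ _ hy hz => rw [map_add, inner_add_right, inner_add_right, hy, hz, mul_add]
    | smul r y _ hy => rw [map_smul, inner_smul_right, inner_smul_right, hy, mul_left_comm]
  | zero => simp
  | add y z _ _ hy hz => rw [inner_add_left, inner_add_left, hy, hz, mul_add]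
  | smul r y _ hy => rw [inner_smul_left, inner_smul_left, hy, mul_left_comm]

/-- The parameters of a graph code, read off from the weights of the vectors `(a, Pa + Bσ)`. -/
theorem isQuantumCode_graphCode (h2 : (2 : F) ≠ 0) {P : Matrix (Fin n) (Fin n) F}
    (hP : P.IsSymm) (B : Matrix (Fin n) κ F) {d : ℕ} (hd : 0 < d)
    (hlow : ∀ a σ, pauliWeight a (P *ᵥ a + B *ᵥ σ) < d → a = 0 ∧ σ = 0)
    (hup : ∃ a σ, pauliWeight a (P *ᵥ a + B *ᵥ σ) = d ∧ (IsEmpty κ ∨ σ ≠ 0)) :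
    IsQuantumCode p (graphCode p P B) (Fintype.card κ) d := by
  classical
  -- `(0, Bσ)` with `Bσ = 0` has weight `0 < d`. So `B` is injective and the graph vectors are
  -- orthogonal.
  have hB : ∀ σ, B *ᵥ σ = 0 → σ = 0 := fun σ hσ =>
    (hlow 0 σ (by simpa [pauliWeight, hσ, hammingNorm] using hd)).2
  have hcard : (Fintype.card F : ℂ) ^ n ≠ 0 := pow_ne_zero _ (by simp)
  have hinner : ∀ s t, inner ℂ (graphVector p P B s) (graphVector p P B t) =
      if s = t then (Fintype.card F : ℂ) ^ n else 0 := by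
    intro s t
    rw [inner_graphVector p h2 hP]
    refine if_congr ⟨fun h => sub_eq_zero.1 (hB _ h), fun h => by simp [h]⟩ rfl rfl
  have hrank : Module.finrank ℂ (graphCode p P B) = Fintype.card F ^ Fintype.card κ := by
    have hli : LinearIndependent ℂ (graphVector p P B) := by
      refine linearIndependent_of_ne_zero_of_inner_eq_zero (fun s hs => hcard ?_) fun s t hst => ?_
      · simpa [hs] using (hinner s s).symm
      · simp [hinner, hst]
    rw [graphCode, finrank_span_eq_card hli, Fintype.card_fun]
  -- The code is pure: light errors other than the identity satisfy `PEP = 0`, which covers both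
  -- clauses of `IsHarmful`.
  have hzero : ∀ a b, pauliWeight a b < d → ¬ (a = 0 ∧ b = 0) → ∀ u ∈ graphCode p P B,
      ∀ v ∈ graphCode p P B, inner ℂ u (pauliError p a b v) = 0 * inner ℂ u v := by
    intro a b hab h0
    refine inner_map_eq_of_mem_span fun s t => ?_
    rw [inner_graphVector_pauliError p h2 hP, if_neg, mul_zero, zero_mul]
    rintro rfl
    obtain ⟨ha, hσ⟩ := hlow _ _ hab
    exact h0 ⟨ha, by simp [ha, hσ]⟩
  refine ⟨hrank, ?_, ?_⟩
  · obtain ⟨a, σ, hw, h⟩ := hup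
    refine ⟨a, _, hw, ?_⟩
    have hne : inner ℂ (graphVector p P B σ) (pauliError p a (P *ᵥ a + B *ᵥ σ)
        (graphVector p P B 0)) ≠ 0 := by
      rw [inner_graphVector_pauliError p h2 hP, sub_zero, if_pos rfl]
      exact mul_ne_zero (traceChar p F |>.val_isUnit _).ne_zero hcard
    have hmem : ∀ s, graphVector p P B s ∈ graphCode p P B := fun s =>
      Submodule.subset_span ⟨s, rfl⟩
    rcases h with h | h
    · refine .inr ⟨by simp [hrank], by omega, _, hmem 0, ?_⟩
      -- For empty `κ` the only label is `0`, so the matrix element is an expectation value.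
      rwa [Subsingleton.elim σ 0] at hne ⊢
    -- For `σ ≠ 0` the error connects two orthogonal vectors of the code, so it is not detected.
    · refine .inl fun ⟨c, hc⟩ => hne ?_
      rw [hc _ (hmem _) _ (hmem _), hinner, if_neg h, mul_zero]
  · rintro _ ⟨a, b, rfl, h⟩
    by_contra! hlt
    by_cases h0 : a = 0 ∧ b = 0
    · obtain ⟨rfl, rfl⟩ := h0
      rcases h with h | ⟨-, h, -⟩
      · exact h ⟨1, fun u _ v _ => by rw [pauliError_zero_zero, one_mul]⟩
      · exact h (by simp [pauliWeight, hammingNorm])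
    · have := hzero a b hlt h0
      rcases h with h | ⟨-, -, u, hu, h⟩
      · exact h ⟨0, this⟩
      · exact h (by rw [this u hu u hu, zero_mul])

/-- Puncturing a graph state: if every non-zero vector `(α, Aα)` has weight at least `d` and some
vector of weight `d` has the last coordinates in its support, then the restriction of `A` gives a
quantum code. -/
theorem exists_isQuantumCode_of_isSymm (h2 : (2 : F) ≠ 0) {ι : Type*} [Fintype ι]
    {A : Matrix ι ι F} (hA : A.IsSymm) (e : Fin n ⊕ κ ≃ ι) {d : ℕ} (hd : Fintype.card κ < d)
    (hlow : ∀ α : ι → F, α ≠ 0 → d ≤ hammingNorm fun i => (α i, (A *ᵥ α) i))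
    {α : ι → F} (hα : hammingNorm (fun i => (α i, (A *ᵥ α) i)) = d)
    (hsupp : ∀ k, α (e (.inr k)) ≠ 0) :
    ∃ Q : Submodule ℂ (QuditSpace F n),
      IsQuantumCode p Q (Fintype.card κ) (d - Fintype.card κ) := by
  let A' := A.submatrix e e
  have hmul : ∀ β : ι → F, ∀ i : Fin n, (A *ᵥ β) (e (.inl i)) =
      (A'.toBlocks₁₁ *ᵥ (fun i => β (e (.inl i))) + A'.toBlocks₁₂ *ᵥ fun k => β (e (.inr k))) i := by
    intro β i
    simp only [mulVec, dotProduct, Pi.add_apply, toBlocks₁₁, toBlocks₁₂, of_apply]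
    rw [← e.sum_comp, Fintype.sum_sum_type]
    rfl
  have hnorm : ∀ β : ι → F, hammingNorm (fun i => (β i, (A *ᵥ β) i)) =
      pauliWeight (fun i => β (e (.inl i))) (A'.toBlocks₁₁ *ᵥ (fun i => β (e (.inl i))) +
        A'.toBlocks₁₂ *ᵥ fun k => β (e (.inr k))) +
      hammingNorm (fun k => (β (e (.inr k)), (A *ᵥ β) (e (.inr k)))) := by
    intro β
    simp only [pauliWeight, ← hmul, hammingNorm, Finset.card_filter]
    rw [← e.sum_comp, Fintype.sum_sum_type]
  refine ⟨graphCode p A'.toBlocks₁₁ A'.toBlocks₁₂, isQuantumCode_graphCode p h2 ?_ _ (by omega) ?_ ?_⟩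
  · ext i j
    exact hA.apply _ _
  · intro a σ h
    let β : ι → F := fun i => Sum.elim a σ (e.symm i)
    have hβ : β = 0 := by
      by_contra hne
      have h1 := hlow β hne
      -- Deleting the coordinates in `κ` lowers the weight by at most `card κ`, and by exactly that
      -- much for the vector `α` of `hup`.
      have h3 : hammingNorm (fun k => (β (e (.inr k)), (A *ᵥ β) (e (.inr k)))) ≤ Fintype.card κ :=
        hammingNorm_le_card_fintype
      rw [hnorm] at h1
      simp only [β, Equiv.symm_apply_apply, Sum.elim_inl, Sum.elim_inr] at h1 h3
      change d ≤ pauliWeight a (A'.toBlocks₁₁ *ᵥ a + A'.toBlocks₁₂ *ᵥ σ) + _ at h1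
      omega
    refine ⟨funext fun i => ?_, funext fun k => ?_⟩
    · simpa [β] using congrFun hβ (e (.inl i))
    · simpa [β] using congrFun hβ (e (.inr k))
  · refine ⟨fun i => α (e (.inl i)), fun k => α (e (.inr k)), ?_, ?_⟩
    · have h1 := hnorm α
      have h3 : hammingNorm (fun k => (α (e (.inr k)), (A *ᵥ α) (e (.inr k)))) = Fintype.card κ := by
        rw [hammingNorm, Finset.filter_true_of_mem, Finset.card_univ]
        exact fun k _ h => hsupp k (congrArg Prod.fst h)
      omega
    · rcases isEmpty_or_nonempty κ with h | ⟨⟨k⟩⟩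
      · exact .inl h
      · exact .inr fun h => hsupp k (congrFun h k)

end GraphCode

/-! ### Circulant matrices and MDS codes -/

section MDS

open Matrix

variable {K : Type*} [Field K] [DecidableEq K] {k : ℕ}

/-- If the small minors of `M` are non-zero, then a codeword `(u, uM)` with `u` non-zero of small
weight has weight greater than `k`. -/
theorem lt_hammingNorm_add_hammingNorm_vecMul {M : Matrix (Fin k) (Fin k) K} {w : ℕ}
    (hM : ∀ m : ℕ, 1 ≤ m → m ≤ w → ∀ r c : Fin m ↪o Fin k, (M.submatrix r c).det ≠ 0)
    {u : Fin k → K} (hu : u ≠ 0) (huw : hammingNorm u ≤ w) :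
    k < hammingNorm u + hammingNorm (u ᵥ* M) := by
  by_contra! hle
  let S : Finset (Fin k) := {i | u i ≠ 0}
  let Z : Finset (Fin k) := {j | (u ᵥ* M) j = 0}
  have hZ : Z.card + hammingNorm (u ᵥ* M) = k := by
    rw [hammingNorm, Finset.card_filter_add_card_filter_not, Finset.card_univ, Fintype.card_fin]
  have hS : S.card = hammingNorm u := rfl
  -- Total weight at most `k` leaves at least as many zeros of `uM` as there are rows in the support
  -- of `u`, which gives a square submatrix annihilated by `u`.
  obtain ⟨T, hTZ, hT⟩ := Finset.exists_subset_card_eq (s := Z) (n := S.card) (by omega)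
  let r : Fin S.card ↪o Fin k := S.orderEmbOfFin rfl
  let c : Fin S.card ↪o Fin k := T.orderEmbOfFin hT
  have hpos : 1 ≤ S.card := by rw [hS]; exact hammingNorm_pos_iff.2 hu
  have hdet := hM S.card hpos (hS ▸ huw) r c
  have hzero : (u ∘ r) ᵥ* M.submatrix r c = 0 := by
    ext j
    have hj : (u ᵥ* M) (c j) = 0 := by
      have := hTZ (T.orderEmbOfFin_mem hT j)
      simpa [Z] using this
    rw [Pi.zero_apply, ← hj]
    simp only [vecMul, dotProduct, submatrix_apply, Function.comp_apply]
    rw [← Finset.sum_subset (Finset.subset_univ S) (f := fun i => u i * M i (c j)),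
      ← Finset.sum_coe_sort S, ← (S.orderIsoOfFin rfl).toEquiv.sum_comp]
    · rfl
    · intro i _ hi
      have : u i = 0 := by simpa [S] using hi
      rw [this, zero_mul]
  have h0 := eq_zero_of_vecMul_eq_zero hdet hzero
  have hmem : r ⟨0, hpos⟩ ∈ S := S.orderEmbOfFin_mem rfl _
  exact (Finset.mem_filter.1 hmem).2 (congrFun h0 ⟨0, hpos⟩)

/-- Let `σ` be a field automorphism with `M σ(M)ᵀ = 1`. If the minors of `M` of size at most half
of that of `M` are non-zero, then `{(u, uM)}` is an MDS code. -/
theorem lt_hammingNorm_add_hammingNorm_vecMul_of_unitary {M : Matrix (Fin k) (Fin k) K}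
    (hM : ∀ m : ℕ, 1 ≤ m → m ≤ k / 2 → ∀ r c : Fin m ↪o Fin k, (M.submatrix r c).det ≠ 0)
    (σ : K →+* K) (hσ : M * (M.map σ)ᵀ = 1) {u : Fin k → K} (hu : u ≠ 0) :
    k < hammingNorm u + hammingNorm (u ᵥ* M) := by
  by_cases h : hammingNorm u ≤ k / 2
  · exact lt_hammingNorm_add_hammingNorm_vecMul hM hu h
  by_cases h' : hammingNorm (u ᵥ* M) ≤ k / 2
  -- Swap roles: `u` is the image of `uM` under `σ(M)ᵀ`, whose minors are images under `σ` of minors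
  -- of `M`.
  · have huM : (u ᵥ* M) ᵥ* (M.map σ)ᵀ = u := by rw [vecMul_vecMul, hσ, vecMul_one]
    have hne : u ᵥ* M ≠ 0 := fun h0 => hu (by rw [← huM, h0, zero_vecMul])
    have := lt_hammingNorm_add_hammingNorm_vecMul (M := (M.map σ)ᵀ) (w := k / 2) ?_ hne h'
    · rwa [huM, add_comm] at this
    · intro m h1 hm r c
      have : (M.map σ)ᵀ.submatrix r c = (σ.mapMatrix (M.submatrix c r))ᵀ := rfl
      rw [this, det_transpose, ← RingHom.map_det]
      exact (map_ne_zero σ).2 (hM m h1 hm c r)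
  -- Both weights are at least `⌊k / 2⌋ + 1`, so their sum exceeds `k`.
  · omega

end MDS

/-! ### Circulant rows under field homomorphisms -/

section Transfer

variable {K L : Type*} [Field K] [Field L] {k : ℕ} [NeZero k]

theorem IsMDSCirculantRow.map {q : ℕ} {x : Fin k → K} (hx : IsMDSCirculantRow q x) (φ : K →+* L) :
    IsMDSCirculantRow q (φ ∘ x) := by
  have hc : rowCirculant (φ ∘ x) = φ.mapMatrix (rowCirculant x) := rfl
  refine ⟨?_, fun m h1 hm r c => ?_, fun m h1 hm => ?_, ?_⟩
  · rw [hc, ← RingHom.map_det]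
    exact (map_ne_zero φ).2 hx.det_ne_zero
  · have : (rowCirculant (φ ∘ x)).submatrix r c =
      φ.mapMatrix ((rowCirculant x).submatrix r c) := rfl
    rw [this, ← RingHom.map_det]
    exact (map_ne_zero φ).2 (hx.minors_ne_zero m h1 hm r c)
  · have := congrArg φ (hx.hermitianShift_eq_zero m h1 hm)
    simpa [hermitianShift, map_sum] using this
  · have := (map_ne_zero φ).2 hx.sum_ne_zero
    simpa [map_sum] using this

end Transfer

/-! ### The field with 25 elements -/

/-- The field `𝔽₅(ω)` with `ω² = 3 + ω`. -/
abbrev GF25 : Type := QuadraticAlgebra (ZMod 5) 3 1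

instance fact_sq_ne : Fact (∀ r : ZMod 5, r ^ 2 ≠ 3 + 1 * r) := ⟨by decide⟩

/-- The first row `(ω¹⁰, ω¹⁰, 1, ω⁶, ω³, ω⁶, 1)`. -/
def mdsRow : Fin 7 → GF25 := ![⟨4, 4⟩, ⟨4, 4⟩, ⟨1, 0⟩, ⟨2, 0⟩, ⟨3, 4⟩, ⟨2, 0⟩, ⟨1, 0⟩]

theorem card_GF25 : Nat.card GF25 = 25 := by
  rw [Nat.card_congr (QuadraticAlgebra.equivProd 3 1)]
  simp

instance : CharP GF25 5 := charP_of_injective_algebraMap (algebraMap (ZMod 5) GF25).injective 5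

/-- The `(i, j)` entry is `H_{i-j}(x)`. Shifts beyond 3 add nothing, as `H_{-m}` is the conjugate of
`H_m`. -/
theorem rowCirculant_mdsRow_mul :
    rowCirculant mdsRow * ((rowCirculant mdsRow).map (frobenius GF25 5)).transpose = 1 := by
  ext1 i j
  simp only [Matrix.mul_apply, Matrix.transpose_apply, Matrix.map_apply, frobenius_def, rowCirculant,
    Matrix.of_apply, Matrix.one_apply]
  revert i j
  decide +kernel

/-- Expanded as in `Matrix.det_fin_three`. The order conditions sit between the quantifiers so that
evaluation can skip non-increasing triples. -/
theorem minors_three :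
    ∀ a b : Fin 7, a < b → ∀ c : Fin 7, b < c → ∀ d e : Fin 7, d < e → ∀ f : Fin 7, e < f →
    mdsRow (d - a) * mdsRow (e - b) * mdsRow (f - c)
     - mdsRow (d - a) * mdsRow (f - b) * mdsRow (e - c)
     - mdsRow (e - a) * mdsRow (d - b) * mdsRow (f - c)
     + mdsRow (e - a) * mdsRow (f - b) * mdsRow (d - c)
     + mdsRow (f - a) * mdsRow (d - b) * mdsRow (e - c)
     - mdsRow (f - a) * mdsRow (e - b) * mdsRow (d - c) ≠ 0 := by
  decide +kernel

theorem minors_two :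
    ∀ a b : Fin 7, a < b → ∀ d e : Fin 7, d < e →
    mdsRow (d - a) * mdsRow (e - b) - mdsRow (e - a) * mdsRow (d - b) ≠ 0 := by
  decide +kernel

theorem isMDSCirculantRow_mdsRow : IsMDSCirculantRow 5 mdsRow := by
  refine ⟨?_, fun m h1 hm r c => ?_, fun m h1 hm => ?_, by decide +kernel⟩
  · exact left_ne_zero_of_mul_eq_one (by rw [← Matrix.det_mul, rowCirculant_mdsRow_mul, Matrix.det_one])
  · have hm3 : m ≤ 3 := hm
    interval_cases m
    · rw [Matrix.det_fin_one]
      exact (by decide : ∀ i, mdsRow i ≠ 0) (c 0 - r 0)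
    · rw [Matrix.det_fin_two]
      exact minors_two _ _ (r.strictMono (by decide)) _ _ (c.strictMono (by decide))
    · rw [Matrix.det_fin_three]
      exact minors_three _ _ (r.strictMono (by decide)) _ (r.strictMono (by decide)) _ _
        (c.strictMono (by decide)) _ (c.strictMono (by decide))
  · have hm3 : m ≤ 3 := hm
    revert m
    decide +kernel

/-! ### The quantum codes -/

section

open Matrix

/-- The adjacency matrix of a graph state equivalent to the stabiliser state of the code
`{(u, uM)}`, where `M` is the circulant matrix with first row `mdsRow`. -/
def mdsGraph : Matrix (Fin 7 ⊕ Fin 7) (Fin 7 ⊕ Fin 7) (ZMod 5) :=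
  fromBlocks (rowCirculant ![3, 1, 0, 0, 0, 0, 1]) (rowCirculant ![2, 2, 3, 4, 4, 4, 3])
    (rowCirculant ![2, 2, 3, 4, 4, 4, 3])ᵀ (rowCirculant ![0, 3, 0, 0, 0, 0, 3])

theorem mdsGraph_isSymm : mdsGraph.IsSymm :=
  .fromBlocks (IsSymm.ext (by simp only [rowCirculant, of_apply]; decide)) rfl
    (IsSymm.ext (by simp only [rowCirculant, of_apply]; decide))

/-- The matrix taking `α` to the first half of the codeword with coordinates `(α, mdsGraph α)`. -/
def mdsGraphLeft : Matrix (Fin 7) (Fin 7 ⊕ Fin 7) GF25 :=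
  of fun i k => ⟨if .inl i = k then 1 else 0, mdsGraph (.inl i) k⟩

/-- The matrix taking `α` to the second half of the codeword with coordinates
`(α, mdsGraph α)`. -/
def mdsGraphRight : Matrix (Fin 7) (Fin 7 ⊕ Fin 7) GF25 :=
  -- The basis `1 + 2ω, 1 + ω` has determinant -1 relative to `1, ω`. As `M` preserves the Hermitian
  -- form, the two halves of `(u, uM)` contribute equally to the symplectic form; this sign makes
  -- them cancel, in agreement with the symmetry of `mdsGraph`.
  of fun i k => (if .inr i = k then 1 else 0 : ZMod 5) • ⟨1, 2⟩ + mdsGraph (.inr i) k • ⟨1, 1⟩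

/-- Certifies that the graph matches the code: each `(α, mdsGraph α)` is the coordinate vector of
some `(u, uM)`. -/
theorem transpose_mul_mdsGraphLeft :
    (rowCirculant mdsRow)ᵀ * mdsGraphLeft = mdsGraphRight := by
  ext1 i k
  rcases k with k | k <;>
    simp only [mul_apply, transpose_apply, rowCirculant, of_apply, mdsGraphLeft, mdsGraphRight,
      mdsGraph, fromBlocks_apply₁₁, fromBlocks_apply₁₂, fromBlocks_apply₂₁, fromBlocks_apply₂₂] <;>
    revert i k <;>
    decide +kernel

variable (α : Fin 7 ⊕ Fin 7 → ZMod 5) (i : Fin 7)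

theorem mdsGraphLeft_mulVec : (mdsGraphLeft *ᵥ (algebraMap (ZMod 5) GF25 ∘ α)) i =
    ⟨α (.inl i), (mdsGraph *ᵥ α) (.inl i)⟩ := by
  simp only [mulVec, dotProduct]
  apply QuadraticAlgebra.ext
  · rw [← QuadraticAlgebra.reₗ_apply, map_sum]
    simp [mdsGraphLeft, QuadraticAlgebra.algebraMap_eq]
  · rw [← QuadraticAlgebra.imₗ_apply, map_sum]
    simp [mdsGraphLeft, QuadraticAlgebra.algebraMap_eq]

theorem mdsGraphRight_mulVec : (mdsGraphRight *ᵥ (algebraMap (ZMod 5) GF25 ∘ α)) i =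
    ⟨α (.inr i) + (mdsGraph *ᵥ α) (.inr i), 2 * α (.inr i) + (mdsGraph *ᵥ α) (.inr i)⟩ := by
  simp only [mulVec, dotProduct]
  apply QuadraticAlgebra.ext
  · rw [← QuadraticAlgebra.reₗ_apply, map_sum]
    simp [mdsGraphRight, QuadraticAlgebra.algebraMap_eq, add_mul, Finset.sum_add_distrib,
      apply_ite QuadraticAlgebra.re]
  · rw [← QuadraticAlgebra.imₗ_apply, map_sum]
    simp [mdsGraphRight, QuadraticAlgebra.algebraMap_eq, add_mul, Finset.sum_add_distrib,
      apply_ite QuadraticAlgebra.im]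

variable {α} in
theorem eight_le_hammingNorm_mdsGraph (hα : α ≠ 0) :
    8 ≤ hammingNorm fun i => (α i, (mdsGraph *ᵥ α) i) := by
  let u := mdsGraphLeft *ᵥ (algebraMap (ZMod 5) GF25 ∘ α)
  have huM : u ᵥ* rowCirculant mdsRow = mdsGraphRight *ᵥ (algebraMap (ZMod 5) GF25 ∘ α) := by
    rw [← mulVec_transpose, mulVec_mulVec, transpose_mul_mdsGraphLeft]
  have hleft : ∀ i, u i ≠ 0 ↔ (α (.inl i), (mdsGraph *ᵥ α) (.inl i)) ≠ 0 := by
    intro i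
    simp [u, mdsGraphLeft_mulVec, QuadraticAlgebra.ext_iff]
  have hright : ∀ i, (u ᵥ* rowCirculant mdsRow) i ≠ 0 ↔
      (α (.inr i), (mdsGraph *ᵥ α) (.inr i)) ≠ 0 := by
    intro i
    rw [huM, mdsGraphRight_mulVec]
    -- Since `1 + 2ω, 1 + ω` is a basis, only the zero pair gives zero; this is a check over 25
    -- pairs.
    generalize α (.inr i) = a, (mdsGraph *ᵥ α) (.inr i) = b
    revert a b
    decide
  have hu : u ≠ 0 := by
    intro h0
    refine hα (funext fun i => ?_)
    rcases i with i | i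
    · exact congrArg Prod.fst (not_not.1 (mt (hleft i).2 (by simp [h0])))
    · exact congrArg Prod.fst (not_not.1 (mt (hright i).2 (by simp [h0])))
  have := lt_hammingNorm_add_hammingNorm_vecMul_of_unitary
    (fun m h1 hm => isMDSCirculantRow_mdsRow.minors_ne_zero m h1 hm) _ rowCirculant_mdsRow_mul hu
  simp only [hammingNorm, hleft, hright, Finset.card_filter] at this
  simp only [hammingNorm, Finset.card_filter, Fintype.sum_sum_type]
  exact this

theorem exists_isQuantumMDSCode {r : ℕ} (hr : r ≤ 6) :
    ∃ Q : Submodule ℂ (QuditSpace (ZMod 5) (14 - r)), IsQuantumMDSCode 5 Q r (8 - r) := by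
  let e : Fin (14 - r) ⊕ Fin r ≃ Fin 7 ⊕ Fin 7 :=
    (finSumFinEquiv.trans (finCongr (by omega : 14 - r + r = 7 + 7))).trans finSumFinEquiv.symm
  -- One vector of weight 8 serves every `r`: its support is `{2, 4}` on the left and `{1, …, 6}` on
  -- the right, so it contains the last six coordinates, from which the `r` deleted ones are taken.
  have hsupp : ∀ k : Fin (7 + 7), 8 ≤ k.val →
      Sum.elim ![0, 0, 1, 0, 4, 0, 0] ![0, 3, 2, 1, 4, 3, 2] (finSumFinEquiv.symm k) ≠
        (0 : ZMod 5) := by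
    decide
  obtain ⟨Q, hQ⟩ := exists_isQuantumCode_of_isSymm 5 (by decide) mdsGraph_isSymm e (d := 8)
    (by rw [Fintype.card_fin]; omega) (fun α => eight_le_hammingNorm_mdsGraph)
    (α := Sum.elim ![0, 0, 1, 0, 4, 0, 0] ![0, 3, 2, 1, 4, 3, 2]) (by decide +kernel)
    (fun k => hsupp _ (by simp; omega))
  rw [Fintype.card_fin] at hQ
  exact ⟨Q, hQ, by omega⟩

end

/-! ### Arbitrary fields with 25 elements -/

section

variable {K : Type*} [Field K]

theorem exists_sq_eq_add_three (hK : Nat.card K = 25) : ∃ ε : K, ε ^ 2 = ε + 3 := by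
  have : Finite K := Nat.finite_of_card_ne_zero (by omega)
  have : Finite GF25 := Nat.finite_of_card_ne_zero (by rw [card_GF25]; norm_num)
  have := Fintype.ofFinite K
  have := Fintype.ofFinite GF25
  let φ : GF25 ≃+* K := FiniteField.ringEquivOfCardEq
    (by rw [Fintype.card_eq_nat_card, Fintype.card_eq_nat_card, hK, card_GF25])
  refine ⟨φ ⟨0, 1⟩, ?_⟩
  rw [← map_pow, ← map_ofNat φ 3, ← map_add]
  exact congrArg φ (by decide)

theorem isMDSCirculantRow_of_sq_eq (hK : Nat.card K = 25) {ε : K} (hε : ε ^ 2 = ε + 3) :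
    IsMDSCirculantRow 5 (![ε ^ 10, ε ^ 10, 1, ε ^ 6, ε ^ 3, ε ^ 6, 1] : Fin 7 → K) := by
  have : Finite K := Nat.finite_of_card_ne_zero (by omega)
  have : CharP K 5 := by
    have := Fintype.ofFinite K
    obtain ⟨n, hp, h⟩ := FiniteField.card K (ringChar K)
    rw [Fintype.card_eq_nat_card, hK] at h
    have : ringChar K = 5 := (Nat.prime_dvd_prime_iff_eq hp (by norm_num)).1
      (hp.dvd_of_dvd_pow ((dvd_pow_self _ n.ne_zero).trans (dvd_of_eq (h.symm.trans (by norm_num : 25 = 5 ^ 2)))))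
    exact this ▸ ringChar.charP K
  let : Algebra (ZMod 5) K := ZMod.algebra K 5
  -- The relation satisfied by `ε` is the defining one of `ω`, so `ω ↦ ε` is a homomorphism
  -- whichever root is chosen.
  let φ : GF25 →ₐ[ZMod 5] K := QuadraticAlgebra.lift ⟨ε, by
    rw [← pow_two, hε, one_smul, Algebra.smul_def, mul_one, map_ofNat, add_comm]⟩
  have hφ : φ ⟨0, 1⟩ = ε := by simp [φ]
  convert isMDSCirculantRow_mdsRow.map (φ : GF25 →+* K) using 1
  have hrow : mdsRow = ![⟨0, 1⟩ ^ 10, ⟨0, 1⟩ ^ 10, 1, ⟨0, 1⟩ ^ 6, ⟨0, 1⟩ ^ 3, ⟨0, 1⟩ ^ 6, 1] := by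
    decide
  funext i
  rw [hrow]
  fin_cases i <;> simp [hφ]

end

theorem mainTheorem9 :
    (∀ (K : Type*) [Field K], Nat.card K = 25 →
      (∃ ε : K, ε ^ 2 = ε + 3) ∧
      ∀ ε : K, ε ^ 2 = ε + 3 →
        IsMDSCirculantRow 5 (![ε ^ 10, ε ^ 10, 1, ε ^ 6, ε ^ 3, ε ^ 6, 1] : Fin 7 → K)) ∧
    (∃ Q : Submodule ℂ (QuditSpace (ZMod 5) 14), IsQuantumMDSCode 5 Q 0 8) ∧
    (∀ r : ℕ, r ≤ 6 →
      ∃ Q : Submodule ℂ (QuditSpace (ZMod 5) (14 - r)), IsQuantumMDSCode 5 Q r (8 - r)) :=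
  ⟨fun _ _ hK => ⟨exists_sq_eq_add_three hK, fun _ hε => isMDSCirculantRow_of_sq_eq hK hε⟩,
    exists_isQuantumMDSCode (Nat.zero_le 6), fun _ hr => exists_isQuantumMDSCode hr⟩
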